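/- Let $n\ge 1$ and consider agents $1,\dots,n$ with scalar states $x_i(t)\in\mathbb R$. Data. For $t\ge 0$ let $\mathcal A(t)=[\mathbf a_{ij}(t)]\in\mathbb R^{n\times n}$ be a nonnegative matrix, and let $\mathcal G(\mathcal A(t))$ be the directed graph on $v_1,\dots,v_n$ in which $(v_j,v_i)$ is an edge iff $\mathbf a_{ij}(t)>0$. Assume that there are constants $0<\check a\le\hat a$ with $\check a\le \mathbf a_{ij}(t)\le\hat a$ whenever $\mathbf a_{ij}(t)\ne 0$. Agent $i$ has update times $t^i_0,t^i_1,t^i_2,\dots$; at time $t^i_k$ it receives the states of the agents in a (possibly empty) set $\mathcal N(t^i_k,i)\subseteq\{j\ne i:\mathbf a_{ij}(t^i_k)>0\}$, the state of agent $j$ arriving with delay $\tau^k_{ij}$. Assume that there are real $\check\tau,\hat\tau$ and an integer $K\ge 0$ such that (A1) $0<\check\tau\le t^i_{k+1}-t^i_k\le\hat\tau$ for all $i$ and all $k\ge 0$; (A2) $t^i_0=0$ for all $i$; (A3) $0\le\tau^k_{ij}\le\tau_d:=K\check\tau$ for all $i$, all $k\ge0$ and all $j\in\mathcal N(t^i_k,i)$.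 The update times of different agents are otherwise unrelated. Dynamics. For every $i$ and $k$, and $t\in[t^i_k,t^i_{k+1})$, $$\dot x_i(t)=\begin{cases}\displaystyle\sum_{j\in\mathcal N(t^i_k,i)}\frac{\mathbf a_{ij}(t^i_k)}{\sum_{l\in\mathcal N(t^i_k,i)}\mathbf a_{il}(t^i_k)}\bigl(x_j(t^i_k-\tau^k_{ij})-x_i(t)\bigr),&\mathcal N(t^i_k,i)\neq\emptyset,\\[2mm]0,&\text{otherwise,}\end{cases}\qquad(\ast)$$ where $x$ is continuous on $[0,\infty)$ and equals a given initial function on $[-\tau_d,0]$ (the derivative at $t^i_k$ being the right derivative). Fix any class $\Phi$ of initial functions that contains all constant functions (for instance all functions, all continuous functions, or only the constant ones). System $(\ast)$ *solves a consensus problem* if for every initial function in $\Phi$ a trajectory exists, and along every trajectory with that initial function there is $a\in\mathbb R$ with $\lim_{t\to\infty}x_i(t)=a$ for all $i$. Graphs. Let $\mathcal G^0(t)$ be the directed graph on $v_1,\dots,v_n$ in which $(v_j,v_i)$ is an edge iff $j\in\mathcal N(t^i_k,i)$ for the $k$ with $t\in[t^i_k,t^i_{k+1})$. The union of $\mathcal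 G^0(t)$ across an interval has as edge set the union of the edge sets of $\mathcal G^0(t)$ over all $t$ in the interval. A directed graph *contains a spanning tree* if some subset of its edges forms a directed tree on all its vertices, that is, a graph with a root vertex that has no parent and from which every other vertex can be reached by a directed path, and in which every other vertex has exactly one parent. Theorem. (i) If there is $T\ge 0$ such that for every $t^0\ge 0$ the union of $\mathcal G^0(t)$ across $[t^0,t^0+T]$ contains a spanning tree, then system $(\ast)$ solves a consensus problem. (ii) If the edge set of $\mathcal G(\mathcal A(t))$ does not depend on $t\ge 0$ (in particular, if $\mathcal A(t)$ is constant) and system $(\ast)$ solves a consensus problem, then $\mathcal G(\mathcal A(t))$ contains a spanning tree. -/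

import Mathlib

open Filter Topology

/-- The directed graph of a weight matrix `A`: `(v_j, v_i)` is an edge iff `a_{ij} > 0`. -/
def matrixGraph {n : ℕ} (A : Matrix (Fin n) (Fin n) ℝ) : Digraph (Fin n) where
  Adj j i := 0 < A i j

/-- `F` is a directed tree with root `r`: the root has no parent, every other vertex has exactly
one parent, and the root is joined to every vertex by a directed path. -/
structure IsDirectedTree {V : Type*} (F : Digraph V) (r : V) : Prop where
  root_no_parent : ∀ u, ¬ F.Adj u r
  unique_parent : ∀ v, v ≠ r → ∃! u, F.Adj u v
  root_reaches : ∀ v, Relation.ReflTransGen F.Adj r v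

/-- `G` contains a spanning tree: some subset of its edges forms a directed tree on all of its
vertices. -/
def HasSpanningTree {V : Type*} (G : Digraph V) : Prop :=
  ∃ F : Digraph V, F ≤ G ∧ ∃ r, IsDirectedTree F r

/-- The data of an asynchronous network of `n` agents with communication delays. -/
structure DelayNetwork (n : ℕ) where
  /-- the weight matrix at each time -/
  weight : ℝ → Matrix (Fin n) (Fin n) ℝ
  /-- `time i k` is the `k`-th update time of agent `i` -/
  time : Fin n → ℕ → ℝ
  /-- `recv i k` is the set of agents whose state information is received by agent `i` at its
  `k`-th update time -/
  recv : Fin n → ℕ → Finset (Fin n)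
  /-- `delay i j k` is the delay of the information that agent `i` receives from agent `j` at the
  `k`-th update time of agent `i` -/
  delay : Fin n → Fin n → ℕ → ℝ

namespace DelayNetwork

variable {n : ℕ} (S : DelayNetwork n)

/-- The actual communication topology at time `t`. -/
def topology (t : ℝ) : Digraph (Fin n) := matrixGraph (S.weight t)

/-- Information is received only from other agents, through channels available at the moment of
the update. -/
def ReceivesThroughChannels : Prop :=
  ∀ i k, ∀ j ∈ S.recv i k, j ≠ i ∧ (S.topology (S.time i k)).Adj j i

/-- The gaps between consecutive update times lie between `τmin > 0` and `τmax`. -/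
def UpdateGaps (τmin τmax : ℝ) : Prop :=
  0 < τmin ∧ ∀ i k, τmin ≤ S.time i (k + 1) - S.time i k ∧
    S.time i (k + 1) - S.time i k ≤ τmax

/-- Every agent has its first update at time zero. -/
def StartsAtZero : Prop := ∀ i, S.time i 0 = 0

/-- The delays of received information lie between `0` and `τd`. -/
def DelaysBounded (τd : ℝ) : Prop :=
  ∀ i k, ∀ j ∈ S.recv i k, 0 ≤ S.delay i j k ∧ S.delay i j k ≤ τd

/-- The weights are nonnegative, and the nonzero ones lie between two positive constants. -/
def WeightsBounded (amin amax : ℝ) : Prop :=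
  0 < amin ∧ amin ≤ amax ∧ ∀ t, 0 ≤ t → ∀ i j, 0 ≤ S.weight t i j ∧
    (S.weight t i j ≠ 0 → amin ≤ S.weight t i j ∧ S.weight t i j ≤ amax)

/-- The graph of information actually received, at time `t`: `(v_j, v_i)` is an edge iff agent `i`
received the state of agent `j` at its latest update. -/
def commGraph (t : ℝ) : Digraph (Fin n) where
  Adj j i := ∃ k, t ∈ Set.Ico (S.time i k) (S.time i (k + 1)) ∧ j ∈ S.recv i k

/-- The union of the graphs `commGraph t` over the time interval `[t₀, t₀ + T]`. -/
def unionGraph (t₀ T : ℝ) : Digraph (Fin n) where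
  Adj j i := ∃ t ∈ Set.Icc t₀ (t₀ + T), (S.commGraph t).Adj j i

/-- The velocity of agent `i` at time `t` in its `k`-th update interval, along `x`. -/
noncomputable def velocity (x : ℝ → Fin n → ℝ) (i : Fin n) (k : ℕ) (t : ℝ) : ℝ :=
  if (S.recv i k).Nonempty then
    ∑ j ∈ S.recv i k,
      S.weight (S.time i k) i j / (∑ l ∈ S.recv i k, S.weight (S.time i k) i l) *
        (x (S.time i k - S.delay i j k) j - x t i)
  else 0

/-- `x` is a trajectory of the delayed system with initial function `φ` on `[-τd, 0]`. In each
update interval the derivative is two-sided in the interior and one-sided at the left end. -/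
structure IsTrajectory (τd : ℝ) (φ x : ℝ → Fin n → ℝ) : Prop where
  initial : ∀ t ∈ Set.Icc (-τd) 0, x t = φ t
  continuous : ∀ i, ContinuousOn (fun t => x t i) (Set.Ici 0)
  dynamics : ∀ i k, ∀ t ∈ Set.Ico (S.time i k) (S.time i (k + 1)),
    HasDerivWithinAt (fun s => x s i) (S.velocity x i k t)
      (Set.Ico (S.time i k) (S.time i (k + 1))) t

/-- The delayed system solves a consensus problem, with initial functions on `[-τd, 0]` taken from
the class `Φ`: each of them starts a trajectory, and along each such trajectory the states of all
agents converge to a common value. -/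
def SolvesConsensus (τd : ℝ) (Φ : Set (ℝ → Fin n → ℝ)) : Prop :=
  ∀ φ ∈ Φ, (∃ x, S.IsTrajectory τd φ x) ∧
    ∀ x, S.IsTrajectory τd φ x → ∃ a : ℝ, ∀ i, Tendsto (fun t => x t i) atTop (𝓝 a)

end DelayNetwork

/-- A directed graph in which one vertex reaches all others contains a spanning tree. -/
theorem hasSpanningTree_of_root {V : Type*} (G : Digraph V) (r : V)
    (hr : ∀ v, Relation.ReflTransGen G.Adj r v) : HasSpanningTree G := by
  classical
  have hlevel : ∃ level : V → ℕ, ∀ v, v ≠ r → ∃ u, G.Adj u v ∧ level u < level v := by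
    let R : ℕ → V → Prop := fun k =>
      Nat.rec (motive := fun _ => V → Prop) (fun v => v = r) (fun _ P v => ∃ u, P u ∧ G.Adj u v) k
    have hR : ∀ v, ∃ k, R k v := fun v => by
      induction hr v with
      | refl => exact ⟨0, rfl⟩
      | tail _ huv ih =>
        obtain ⟨k, hk⟩ := ih
        exact ⟨k + 1, _, hk, huv⟩
    refine ⟨fun v => Nat.find (hR v), fun v hv => ?_⟩
    have hspec := Nat.find_spec (hR v)
    cases hk : Nat.find (hR v) with
    | zero => rw [hk] at hspec; exact absurd hspec hv
    | succ k =>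
      rw [hk] at hspec
      obtain ⟨u, hu, huv⟩ := hspec
      refine ⟨u, huv, ?_⟩
      change Nat.find (hR u) < Nat.find (hR v)
      rw [hk]
      exact Nat.lt_succ_of_le (Nat.find_min' (hR u) hu)
  obtain ⟨level, hlevel⟩ := hlevel
  choose! parent hadj hlt using hlevel
  refine ⟨⟨fun u v => v ≠ r ∧ u = parent v⟩, ?_, r, ?_, ?_, ?_⟩
  · rintro u v ⟨hv, rfl⟩
    exact hadj v hv
  · rintro u ⟨h, -⟩
    exact h rfl
  · intro v hv
    exact ⟨parent v, ⟨hv, rfl⟩, fun u hu => hu.2⟩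
  · intro v
    induction hm : level v using Nat.strong_induction_on generalizing v with
    | _ m ih =>
      by_cases hv : v = r
      · rw [hv]
      · exact (ih _ (hm ▸ hlt v hv) _ rfl).tail ⟨hv, rfl⟩

/-- A finite directed graph without a spanning tree has two vertices without common ancestor. -/
theorem exists_disjoint_ancestors {V : Type*} [Finite V] [Nonempty V] (G : Digraph V)
    (hG : ¬ HasSpanningTree G) :
    ∃ u v, ∀ w, Relation.ReflTransGen G.Adj w u → ¬ Relation.ReflTransGen G.Adj w v := by
  by_contra! hcon
  have : IsTrans V (flip (Relation.ReflTransGen G.Adj)) := ⟨fun _ _ _ h h' => h'.trans h⟩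
  have hdir : Directed (flip (Relation.ReflTransGen G.Adj)) (id : V → V) := fun u v => by
    obtain ⟨w, hu, hv⟩ := hcon u v
    exact ⟨w, hu, hv⟩
  obtain ⟨r, hr⟩ := hdir.finite_le id
  exact hG (hasSpanningTree_of_root G r hr)

/-- A set containing the root of a directed tree, but not all vertices, is left by some edge. -/
theorem exists_edge_leaving {V : Type*} {G : Digraph V} {r : V}
    (hr : ∀ v, Relation.ReflTransGen G.Adj r v) {A : Set V} (hrA : r ∈ A) {v : V} (hv : v ∉ A) :
    ∃ j ∈ A, ∃ i ∉ A, G.Adj j i := by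
  by_contra! hcon
  apply hv
  induction hr v with
  | refl => exact hrA
  | tail _ huv ih =>
    by_contra hc
    exact hcon _ (by by_contra h; exact hc (by tauto)) _ hc huv

theorem HasSpanningTree.exists_root {V : Type*} {G : Digraph V} (h : HasSpanningTree G) :
    ∃ r, ∀ v, Relation.ReflTransGen G.Adj r v := by
  obtain ⟨F, hF, r, hr⟩ := h
  exact ⟨r, fun v => (hr.root_reaches v).lift id fun _ _ huv => hF huv⟩

namespace DelayNetwork

variable {n : ℕ} {S : DelayNetwork n} {τmin τmax τd amin amax : ℝ}

/-- The standing assumptions on a delay network. -/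
structure Admissible (S : DelayNetwork n) (τmin τmax τd amin amax : ℝ) : Prop where
  recv : S.ReceivesThroughChannels
  gaps : S.UpdateGaps τmin τmax
  start : S.StartsAtZero
  delays : S.DelaysBounded τd
  weights : S.WeightsBounded amin amax

/-- The number of updates, of all agents, before time `t`. -/
noncomputable def eventCount (S : DelayNetwork n) (t : ℝ) : ℕ :=
  {p : Fin n × ℕ | S.time p.1 p.2 < t}.ncard

/-- The value that agent `i` is attracted to after its `k`-th update. -/
noncomputable def aim (S : DelayNetwork n) (x : ℝ → Fin n → ℝ) (i : Fin n) (k : ℕ) : ℝ :=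
  if (S.recv i k).Nonempty then
    ∑ j ∈ S.recv i k,
      S.weight (S.time i k) i j / (∑ l ∈ S.recv i k, S.weight (S.time i k) i l) *
        x (S.time i k - S.delay i j k) j
  else x (S.time i k) i

/-- The fraction of an agent's state that its listeners have inherited after a time `L`. -/
noncomputable def inherit (n : ℕ) (τmin amin amax L : ℝ) : ℝ :=
  Real.exp (-L) * (Real.exp (-L) * (amin / (n * amax) * (1 - Real.exp (-τmin))))

/-- In each update interval, every agent relaxes exponentially to its aim. -/
def Relaxes (S : DelayNetwork n) (x : ℝ → Fin n → ℝ) : Prop :=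
  ∀ i k, ∀ t ∈ Set.Icc (S.time i k) (S.time i (k + 1)),
    x t i = S.aim x i k + Real.exp (-(t - S.time i k)) * (x (S.time i k) i - S.aim x i k)

theorem UpdateGaps.strictMono (h : S.UpdateGaps τmin τmax) (i : Fin n) :
    StrictMono (S.time i) :=
  strictMono_nat_of_lt_succ fun k => by linarith [h.1, (h.2 i k).1]

namespace Admissible

theorem mul_le_time (h : S.Admissible τmin τmax τd amin amax) (i : Fin n) (k : ℕ) :
    k * τmin ≤ S.time i k := by
  induction k with
  | zero => simp [h.start i]
  | succ k ih => push_cast; linarith [(h.gaps.2 i k).1]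

theorem time_nonneg (h : S.Admissible τmin τmax τd amin amax) (i : Fin n) (k : ℕ) :
    0 ≤ S.time i k :=
  (mul_nonneg k.cast_nonneg h.gaps.1.le).trans (h.mul_le_time i k)

theorem exists_lt_time (h : S.Admissible τmin τmax τd amin amax) (i : Fin n) (t : ℝ) :
    ∃ k, t < S.time i k := by
  obtain ⟨k, hk⟩ := exists_nat_gt (t / τmin)
  exact ⟨k, ((div_lt_iff₀ h.gaps.1).1 hk).trans_le (h.mul_le_time i k)⟩

theorem exists_mem_Ioc (h : S.Admissible τmin τmax τd amin amax) (i : Fin n) {t : ℝ}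
    (ht : 0 < t) : ∃ k, t ∈ Set.Ioc (S.time i k) (S.time i (k + 1)) := by
  classical
  have hex : ∃ k, t ≤ S.time i k := (h.exists_lt_time i t).imp fun _ => le_of_lt
  have hspec := Nat.find_spec hex
  cases hk : Nat.find hex with
  | zero => rw [hk, h.start i] at hspec; linarith
  | succ k =>
    rw [hk] at hspec
    exact ⟨k, not_le.1 (Nat.find_min hex (by omega)), hspec⟩

theorem finite_events (h : S.Admissible τmin τmax τd amin amax) (t : ℝ) :
    {p : Fin n × ℕ | S.time p.1 p.2 < t}.Finite := by
  obtain ⟨N, hN⟩ := exists_nat_gt (t / τmin)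
  refine (Set.finite_univ.prod (Set.finite_lt_nat N)).subset fun p hp => ⟨trivial, ?_⟩
  by_contra! hc
  have h1 : t < N * τmin := (div_lt_iff₀ h.gaps.1).1 hN
  have h2 : (N : ℝ) * τmin ≤ p.2 * τmin :=
    mul_le_mul_of_nonneg_right (by exact_mod_cast not_lt.1 hc) h.gaps.1.le
  have h3 : S.time p.1 p.2 < t := hp
  linarith [h.mul_le_time p.1 p.2]

theorem eventCount_lt (h : S.Admissible τmin τmax τd amin amax) {i : Fin n} {k : ℕ} {s t : ℝ}
    (hs : s ≤ S.time i k) (ht : S.time i k < t) : S.eventCount s < S.eventCount t := by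
  refine Set.ncard_lt_ncard ⟨fun p hp => ?_, fun hsub => ?_⟩ (h.finite_events t)
  · exact lt_trans hp (hs.trans_lt ht)
  · exact absurd (@hsub (i, k) ht) (not_lt.2 hs)

theorem weight_pos (h : S.Admissible τmin τmax τd amin amax) {i j : Fin n} {k : ℕ}
    (hj : j ∈ S.recv i k) : 0 < S.weight (S.time i k) i j :=
  (h.recv i k j hj).2

theorem sum_weight_pos (h : S.Admissible τmin τmax τd amin amax) {i : Fin n} {k : ℕ}
    (hk : (S.recv i k).Nonempty) : 0 < ∑ l ∈ S.recv i k, S.weight (S.time i k) i l :=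
  Finset.sum_pos (fun _ hj => h.weight_pos hj) hk

theorem sum_div_eq_one (h : S.Admissible τmin τmax τd amin amax) {i : Fin n} {k : ℕ}
    (hk : (S.recv i k).Nonempty) :
    ∑ j ∈ S.recv i k,
      S.weight (S.time i k) i j / (∑ l ∈ S.recv i k, S.weight (S.time i k) i l) = 1 := by
  rw [← Finset.sum_div, div_self (h.sum_weight_pos hk).ne']

/-- The relative weight of each received state has a uniform positive lower bound. -/
theorem le_relative_weight (h : S.Admissible τmin τmax τd amin amax) {i j : Fin n} {k : ℕ}
    (hj : j ∈ S.recv i k) :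
    amin / (n * amax) ≤
      S.weight (S.time i k) i j / (∑ l ∈ S.recv i k, S.weight (S.time i k) i l) := by
  have hw := fun {l : Fin n} (hl : l ∈ S.recv i k) =>
    (h.weights.2.2 (S.time i k) (h.time_nonneg i k) i l).2 (h.weight_pos hl).ne'
  refine div_le_div₀ (h.weight_pos hj).le (hw hj).1 (h.sum_weight_pos ⟨j, hj⟩) ?_
  calc ∑ l ∈ S.recv i k, S.weight (S.time i k) i l
      ≤ ∑ _l ∈ S.recv i k, amax := Finset.sum_le_sum fun l hl => (hw hl).2
    _ = (S.recv i k).card * amax := by simp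
    _ ≤ n * amax := by
        have : (S.recv i k).card ≤ n := by simpa using Finset.card_le_univ (S.recv i k)
        have : 0 < amax := h.weights.1.trans_le h.weights.2.1
        gcongr

theorem aim_nonneg (h : S.Admissible τmin τmax τd amin amax) {x : ℝ → Fin n → ℝ} {i : Fin n}
    {k : ℕ} (hrecv : ∀ j ∈ S.recv i k, 0 ≤ x (S.time i k - S.delay i j k) j)
    (hself : 0 ≤ x (S.time i k) i) : 0 ≤ S.aim x i k := by
  unfold aim
  split_ifs with hk
  · exact Finset.sum_nonneg fun j hj =>
      mul_nonneg (div_nonneg (h.weight_pos hj).le (h.sum_weight_pos hk).le) (hrecv j hj)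
  · exact hself

theorem mul_le_aim (h : S.Admissible τmin τmax τd amin amax) {x : ℝ → Fin n → ℝ} {i j : Fin n}
    {k : ℕ} (hrecv : ∀ j ∈ S.recv i k, 0 ≤ x (S.time i k - S.delay i j k) j)
    (hj : j ∈ S.recv i k) :
    amin / (n * amax) * x (S.time i k - S.delay i j k) j ≤ S.aim x i k := by
  rw [aim, if_pos ⟨j, hj⟩]
  refine (mul_le_mul_of_nonneg_right (h.le_relative_weight hj) (hrecv j hj)).trans ?_
  exact Finset.single_le_sum (f := fun j => S.weight (S.time i k) i j /
    (∑ l ∈ S.recv i k, S.weight (S.time i k) i l) * x (S.time i k - S.delay i j k) j)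
    (fun l hl => mul_nonneg (div_nonneg (h.weight_pos hl).le (h.sum_weight_pos ⟨j, hj⟩).le)
      (hrecv l hl)) hj

theorem aim_affine (h : S.Admissible τmin τmax τd amin amax) (x : ℝ → Fin n → ℝ) (a b : ℝ)
    (i : Fin n) (k : ℕ) : S.aim (fun t j => a + b * x t j) i k = a + b * S.aim x i k := by
  unfold aim
  split_ifs with hk
  · simp only [mul_add, Finset.sum_add_distrib, ← Finset.sum_mul, h.sum_div_eq_one hk, one_mul,
      Finset.mul_sum]
    congr 1
    exact Finset.sum_congr rfl fun j _ => by ring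
  · rfl

theorem relaxes_affine (h : S.Admissible τmin τmax τd amin amax) {x : ℝ → Fin n → ℝ}
    (hx : S.Relaxes x) (a b : ℝ) : S.Relaxes fun t j => a + b * x t j := fun i k t ht => by
  simp only [h.aim_affine, hx i k t ht]
  ring

end Admissible

theorem Relaxes.eq_of_le {x : ℝ → Fin n → ℝ} (hx : S.Relaxes x) {i : Fin n} {k : ℕ} {s t : ℝ}
    (hs : S.time i k ≤ s) (hst : s ≤ t) (ht : t ≤ S.time i (k + 1)) :
    x t i = S.aim x i k + Real.exp (-(t - s)) * (x s i - S.aim x i k) := by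
  rw [hx i k t ⟨hs.trans hst, ht⟩, hx i k s ⟨hs, hst.trans ht⟩, add_sub_cancel_left, ← mul_assoc,
    ← Real.exp_add]
  ring_nf

theorem Relaxes.exp_mul_le_local {x : ℝ → Fin n → ℝ} (hx : S.Relaxes x) {i : Fin n} {k : ℕ}
    {s t : ℝ} (haim : 0 ≤ S.aim x i k) (hs : S.time i k ≤ s) (hst : s ≤ t)
    (ht : t ≤ S.time i (k + 1)) : Real.exp (-(t - s)) * x s i ≤ x t i := by
  have h1 : Real.exp (-(t - s)) ≤ 1 := Real.exp_le_one_iff.2 (by linarith)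
  rw [hx.eq_of_le hs hst ht]
  nlinarith

namespace Admissible

/-- A set of agents that receives nothing from outside keeps nonnegative states nonnegative. -/
theorem nonneg_of_window (h : S.Admissible τmin τmax τd amin amax) {x : ℝ → Fin n → ℝ}
    (hx : S.Relaxes x) (P : Set (Fin n)) (hP : ∀ i ∈ P, ∀ k, ∀ j ∈ S.recv i k, j ∈ P) {t₀ : ℝ}
    (ht₀ : 0 ≤ t₀) (hτd : 0 ≤ τd)
    (hw : ∀ s, -τd ≤ s → t₀ - (τd + τmax) ≤ s → s ≤ t₀ → ∀ i ∈ P, 0 ≤ x s i) :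
    ∀ s, -τd ≤ s → t₀ - (τd + τmax) ≤ s → ∀ i ∈ P, 0 ≤ x s i := by
  intro s
  induction hm : S.eventCount s using Nat.strong_induction_on generalizing s with
  | _ m ih =>
    intro hs1 hs2 i hi
    by_cases hst : s ≤ t₀
    · exact hw s hs1 hs2 hst i hi
    push Not at hst
    obtain ⟨k, hk1, hk2⟩ := h.exists_mem_Ioc i (ht₀.trans_lt hst)
    have hgap := (h.gaps.2 i k).2
    have h0 := h.time_nonneg i k
    have hself : 0 ≤ x (S.time i k) i :=
      ih _ (hm ▸ h.eventCount_lt le_rfl hk1) _ rfl (by linarith) (by linarith) i hi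
    have haim : 0 ≤ S.aim x i k := h.aim_nonneg (fun j hj => by
      have hd := h.delays i k j hj
      exact ih _ (hm ▸ h.eventCount_lt (by linarith) hk1) _ rfl (by linarith) (by linarith) j
        (hP i hi k j hj)) hself
    exact (mul_nonneg (Real.exp_pos _).le hself).trans
      (hx.exp_mul_le_local haim le_rfl hk1.le hk2)

theorem aim_nonneg_of_nonneg (h : S.Admissible τmin τmax τd amin amax) (hτd : 0 ≤ τd)
    {x : ℝ → Fin n → ℝ} {b : ℝ} (hpos : ∀ s, b ≤ s → ∀ i, 0 ≤ x s i) {i : Fin n} {k : ℕ}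
    (hk : b + τd ≤ S.time i k) : 0 ≤ S.aim x i k :=
  h.aim_nonneg (fun j hj => hpos _ (by linarith [(h.delays i k j hj).2]) j)
    (hpos _ (by linarith) i)

theorem exp_mul_le (h : S.Admissible τmin τmax τd amin amax) (hτd : 0 ≤ τd)
    {x : ℝ → Fin n → ℝ} (hx : S.Relaxes x) {b : ℝ} (hb : 0 ≤ b)
    (hpos : ∀ s, b ≤ s → ∀ i, 0 ≤ x s i) {s t : ℝ} (hs : b + (τd + τmax) ≤ s) (hst : s ≤ t)
    (i : Fin n) : Real.exp (-(t - s)) * x s i ≤ x t i := by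
  have hτ := h.gaps.1
  have hgap := fun k => h.gaps.2 i k
  induction hm : S.eventCount t using Nat.strong_induction_on generalizing t with
  | _ m ih =>
    rcases hst.eq_or_lt with rfl | hlt
    · simp
    obtain ⟨k, hk1, hk2⟩ := h.exists_mem_Ioc i (t := t) (by linarith [hgap 0])
    have haim : 0 ≤ S.aim x i k :=
      h.aim_nonneg_of_nonneg hτd hpos (by linarith [hgap k])
    rcases le_total (S.time i k) s with hks | hks
    · exact hx.exp_mul_le_local haim hks hst hk2
    · have h1 := ih _ (hm ▸ h.eventCount_lt le_rfl hk1) hks rfl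
      have h2 := hx.exp_mul_le_local haim le_rfl hk1.le hk2
      refine le_trans ?_ h2
      rw [show -(t - s) = -(t - S.time i k) + -(S.time i k - s) by ring, Real.exp_add, mul_assoc]
      exact mul_le_mul_of_nonneg_left h1 (Real.exp_pos _).le

theorem exp_neg_mul_le (h : S.Admissible τmin τmax τd amin amax) (hτd : 0 ≤ τd)
    {x : ℝ → Fin n → ℝ} (hx : S.Relaxes x) {b : ℝ} (hb : 0 ≤ b)
    (hpos : ∀ s, b ≤ s → ∀ i, 0 ≤ x s i) {s t L : ℝ} (hs : b + (τd + τmax) ≤ s) (hst : s ≤ t)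
    (ht : t ≤ s + L) (hbs : b ≤ s) (i : Fin n) : Real.exp (-L) * x s i ≤ x t i :=
  (mul_le_mul_of_nonneg_right (Real.exp_le_exp.2 (by linarith)) (hpos s hbs i)).trans
    (h.exp_mul_le hτd hx hb hpos hs hst i)

theorem inherit_mul_le (h : S.Admissible τmin τmax τd amin amax) (hτd : 0 ≤ τd)
    {x : ℝ → Fin n → ℝ} (hx : S.Relaxes x) {b : ℝ} (hb : 0 ≤ b)
    (hpos : ∀ s, b ≤ s → ∀ i, 0 ≤ x s i) {u L : ℝ} (hu : b + (τd + τmax) ≤ u) {i j : Fin n}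
    {k : ℕ} (hj : j ∈ S.recv i k) (hk1 : u + τd ≤ S.time i k) (hk2 : S.time i (k + 1) ≤ u + L) :
    inherit n τmin amin amax L * x u j ≤ x (u + L) i := by
  have hτ := h.gaps.1
  have hgap := h.gaps.2 i k
  have hd := h.delays i k j hj
  have hbu : b ≤ u := by linarith
  have h1 : Real.exp (-L) * x u j ≤ x (S.time i k - S.delay i j k) j :=
    h.exp_neg_mul_le hτd hx hb hpos hu (by linarith) (by linarith) hbu j
  have hw : 0 ≤ amin / (n * amax) := by
    have := h.weights.1.le
    have := this.trans h.weights.2.1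
    positivity
  have h2 := h.mul_le_aim (x := x) (fun j hj => hpos _ (by
    linarith [(h.delays i k j hj).2]) j) hj
  have haim := h.aim_nonneg_of_nonneg hτd hpos (i := i) (k := k) (by linarith)
  have hself := hpos (S.time i k) (by linarith) i
  have h3 : (1 - Real.exp (-τmin)) * S.aim x i k ≤ x (S.time i (k + 1)) i := by
    rw [hx i k _ ⟨by linarith, le_rfl⟩]
    have he : Real.exp (-(S.time i (k + 1) - S.time i k)) ≤ Real.exp (-τmin) :=
      Real.exp_le_exp.2 (by linarith)
    have := Real.exp_pos (-(S.time i (k + 1) - S.time i k))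
    nlinarith
  have h4 : Real.exp (-L) * x (S.time i (k + 1)) i ≤ x (u + L) i :=
    h.exp_neg_mul_le hτd hx hb hpos (by linarith) hk2 (by linarith) (by linarith) i
  have he1 : 0 ≤ 1 - Real.exp (-τmin) := by
    linarith [Real.exp_le_one_iff.2 (show -τmin ≤ 0 by linarith)]
  calc inherit n τmin amin amax L * x u j
      = Real.exp (-L) * ((1 - Real.exp (-τmin)) * (amin / (n * amax) *
          (Real.exp (-L) * x u j))) := by unfold inherit; ring
    _ ≤ Real.exp (-L) * ((1 - Real.exp (-τmin)) * (amin / (n * amax) *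
          x (S.time i k - S.delay i j k) j)) := by gcongr
    _ ≤ Real.exp (-L) * ((1 - Real.exp (-τmin)) * S.aim x i k) := by gcongr
    _ ≤ Real.exp (-L) * x (S.time i (k + 1)) i := by gcongr
    _ ≤ x (u + L) i := h4

theorem inherit_pos (h : S.Admissible τmin τmax τd amin amax) (hn : 0 < n) (L : ℝ) :
    0 < inherit n τmin amin amax L := by
  have h1 := h.weights.1
  have h2 := h1.trans_le h.weights.2.1
  have h3 : 0 < 1 - Real.exp (-τmin) := by
    linarith [Real.exp_lt_exp.2 (show -τmin < 0 by linarith [h.gaps.1]), Real.exp_zero]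
  unfold inherit
  positivity

theorem inherit_le (h : S.Admissible τmin τmax τd amin amax) (hn : 0 < n) {L : ℝ} (hL : 0 ≤ L) :
    inherit n τmin amin amax L ≤ Real.exp (-L) := by
  have h1 := h.weights.1
  have h2 := h1.trans_le h.weights.2.1
  have h3 : (1 : ℝ) ≤ n := by exact_mod_cast hn
  have h4 : amin / (n * amax) ≤ 1 := (div_le_one (by positivity)).2 (by nlinarith [h.weights.2.1])
  have h5 : Real.exp (-L) ≤ 1 := Real.exp_le_one_iff.2 (by linarith)
  have h6 : 0 ≤ 1 - Real.exp (-τmin) := by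
    linarith [Real.exp_le_one_iff.2 (show -τmin ≤ 0 by linarith [h.gaps.1])]
  have h7 : 1 - Real.exp (-τmin) ≤ 1 := by linarith [Real.exp_pos (-τmin)]
  have h8 : 0 ≤ amin / (n * amax) := by positivity
  exact mul_le_of_le_one_right (Real.exp_pos _).le
    (mul_le_one₀ h5 (mul_nonneg h8 h6) (mul_le_one₀ h4 h6 h7))

/-- If every agent of `A` has a state at least `δ`, then the same holds later for `inherit * δ`,
and when `A` contains the root of a union graph but not all agents, for a larger set. -/
theorem exists_larger (h : S.Admissible τmin τmax τd amin amax) (hn : 0 < n) (hτd : 0 ≤ τd)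
    {x : ℝ → Fin n → ℝ} (hx : S.Relaxes x) {b : ℝ} (hb : 0 ≤ b)
    (hpos : ∀ s, b ≤ s → ∀ i, 0 ≤ x s i) {u T : ℝ} (hT : 0 ≤ T) (hu : b + (τd + τmax) ≤ u)
    {r : Fin n} (hr : ∀ v, Relation.ReflTransGen (S.unionGraph (u + (τd + τmax)) T).Adj r v)
    (A : Finset (Fin n)) {δ : ℝ} (hδ : 0 ≤ δ) (hA : ∀ i ∈ A, δ ≤ x u i) :
    ∃ A' : Finset (Fin n), A ⊆ A' ∧ (r ∈ A → A' = Finset.univ ∨ A.card + 1 ≤ A'.card) ∧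
      ∀ i ∈ A', inherit n τmin amin amax (τd + τmax + T + τmax) * δ ≤
        x (u + (τd + τmax + T + τmax)) i := by
  classical
  have hτ := h.gaps.1
  have hτmax : 0 ≤ τmax := by linarith [h.gaps.2 r 0]
  set L := τd + τmax + T + τmax
  have hkeep : ∀ i ∈ A, inherit n τmin amin amax L * δ ≤ x (u + L) i := fun i hi =>
    (mul_le_mul (h.inherit_le hn (by positivity)) (hA i hi) hδ (Real.exp_pos _).le).trans
      (h.exp_neg_mul_le hτd hx hb hpos hu (by simp only [L]; linarith) le_rfl (by linarith) i)
  by_cases hgrow : r ∈ A ∧ A ≠ Finset.univ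
  · obtain ⟨v, hv⟩ : ∃ v, v ∉ A := by
      by_contra! hc
      exact hgrow.2 (Finset.eq_univ_iff_forall.2 hc)
    obtain ⟨j, hj, i, hi, s, hs, k, hk, hjk⟩ :=
      exists_edge_leaving hr (A := (A : Set (Fin n))) hgrow.1 (v := v) hv
    have hgap := h.gaps.2 i k
    have hs1 := hs.1
    have hs2 := hs.2
    have hk1 := hk.1
    have hk2 := hk.2
    have hnew := h.inherit_mul_le hτd hx hb hpos hu (L := L) hjk (by linarith)
      (by simp only [L]; linarith)
    refine ⟨insert i A, Finset.subset_insert _ _, fun _ => Or.inr ?_, fun l hl => ?_⟩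
    · rw [Finset.card_insert_of_notMem (by simpa using hi)]
    · rcases Finset.mem_insert.1 hl with rfl | hl
      · exact (mul_le_mul_of_nonneg_left (hA j hj) (h.inherit_pos hn L).le).trans hnew
      · exact hkeep l hl
  · refine ⟨A, subset_rfl, fun hrA => Or.inl ?_, hkeep⟩
    by_contra hc
    exact hgrow ⟨hrA, hc⟩

/-- A common positive lower bound of all agents at one time yields one for all later times. -/
theorem exp_mul_le_of_forall_le (h : S.Admissible τmin τmax τd amin amax) (hτd : 0 ≤ τd)
    (hτmax : 0 ≤ τmax) {x : ℝ → Fin n → ℝ} (hx : S.Relaxes x) {b : ℝ} (hb : 0 ≤ b)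
    (hpos : ∀ s, b ≤ s → ∀ i, 0 ≤ x s i) {u d : ℝ} (hu : b + (τd + τmax) ≤ u)
    (hd : ∀ i, d ≤ x u i) : ∀ s, u ≤ s → ∀ i, Real.exp (-(τd + τmax)) * d ≤ x s i := by
  intro s hs i
  have := h.nonneg_of_window (h.relaxes_affine hx (-(Real.exp (-(τd + τmax)) * d)) 1) Set.univ
    (fun _ _ _ _ _ => trivial) (t₀ := u + (τd + τmax)) (by linarith) hτd
    (fun s _ hs1 hs2 i _ => by
      have h1 := h.exp_neg_mul_le hτd hx hb hpos hu (t := s) (L := τd + τmax) (by linarith)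
        (by linarith) (by linarith) i
      have h2 := mul_le_mul_of_nonneg_left (hd i) (Real.exp_pos (-(τd + τmax))).le
      linarith) s (by linarith) (by linarith) i trivial
  linarith

/-- After `p` windows, either one side of the interval `[m, M]` is avoided by all agents, or at
least `n + p` times an agent avoids a side. -/
theorem exists_avoiding (h : S.Admissible τmin τmax τd amin amax) (hn : 0 < n) (hτd : 0 ≤ τd)
    {x : ℝ → Fin n → ℝ} (hx : S.Relaxes x) {T : ℝ} (hT : 0 ≤ T)
    (hG : ∀ t₀ : ℝ, 0 ≤ t₀ → HasSpanningTree (S.unionGraph t₀ T)) {b m M : ℝ} (hb : 0 ≤ b)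
    (hm : ∀ s, b ≤ s → ∀ i, m ≤ x s i) (hM : ∀ s, b ≤ s → ∀ i, x s i ≤ M) {L : ℝ}
    (hL : L = τd + τmax + T + τmax) (hτmax : 0 ≤ τmax) (p : ℕ) :
    ∃ A B : Finset (Fin n),
      (∀ i ∈ A, inherit n τmin amin amax L ^ p * ((M - m) / 2) ≤
        -m + 1 * x (b + (τd + τmax) + p * L) i) ∧
      (∀ i ∈ B, inherit n τmin amin amax L ^ p * ((M - m) / 2) ≤
        M + -1 * x (b + (τd + τmax) + p * L) i) ∧
      (∀ i, i ∈ A ∨ i ∈ B) ∧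
      (A = Finset.univ ∨ B = Finset.univ ∨ n + p ≤ A.card + B.card) := by
  classical
  have hL0 : 0 ≤ L := by rw [hL]; positivity
  have hmM : m ≤ M := (hm b le_rfl ⟨0, hn⟩).trans (hM b le_rfl ⟨0, hn⟩)
  induction p with
  | zero =>
    refine ⟨Finset.univ.filter fun i => (M + m) / 2 ≤ x (b + (τd + τmax)) i,
      Finset.univ.filter fun i => ¬ (M + m) / 2 ≤ x (b + (τd + τmax)) i, fun i hi => ?_,
      fun i hi => ?_, fun i => ?_, Or.inr (Or.inr ?_)⟩
    · have := (Finset.mem_filter.1 hi).2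
      simp only [pow_zero, Nat.cast_zero, zero_mul, add_zero]
      linarith
    · have := not_le.1 (Finset.mem_filter.1 hi).2
      simp only [pow_zero, Nat.cast_zero, zero_mul, add_zero]
      linarith
    · simpa using le_or_gt _ _
    · rw [Finset.card_filter_add_card_filter_not]
      simp
  | succ p ih =>
    obtain ⟨A, B, hA, hB, hAB, hcard⟩ := ih
    have hpL : 0 ≤ (p : ℝ) * L := by positivity
    have hδ : 0 ≤ inherit n τmin amin amax L ^ p * ((M - m) / 2) :=
      mul_nonneg (pow_nonneg (h.inherit_pos hn L).le p) (by linarith)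
    obtain ⟨r, hr⟩ := (hG (b + (τd + τmax) + p * L + (τd + τmax)) (by positivity)).exists_root
    obtain ⟨A', hAA', hgA, hA'⟩ := h.exists_larger hn hτd (h.relaxes_affine hx (-m) 1) hb
      (fun s hs i => by linarith [hm s hs i]) hT (by linarith) hr A hδ hA
    obtain ⟨B', hBB', hgB, hB'⟩ := h.exists_larger hn hτd (h.relaxes_affine hx M (-1)) hb
      (fun s hs i => by linarith [hM s hs i]) hT (by linarith) hr B hδ hB
    rw [← hL] at hA' hB'
    have ht : b + (τd + τmax) + ((p + 1 : ℕ) : ℝ) * L = b + (τd + τmax) + p * L + L := by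
      push_cast; ring
    have hpow : inherit n τmin amin amax L ^ (p + 1) * ((M - m) / 2) =
      inherit n τmin amin amax L * (inherit n τmin amin amax L ^ p * ((M - m) / 2)) := by ring
    rw [ht, hpow]
    refine ⟨A', B', hA', hB', fun i => (hAB i).imp (@hAA' i) (@hBB' i), ?_⟩
    have hcA := Finset.card_le_card hAA'
    have hcB := Finset.card_le_card hBB'
    rcases hcard with rfl | rfl | hcard
    · exact Or.inl (Finset.univ_subset_iff.1 hAA')
    · exact Or.inr (Or.inl (Finset.univ_subset_iff.1 hBB'))
    · rcases hAB r with hrA | hrB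
      · rcases hgA hrA with h1 | h1
        · exact Or.inl h1
        · exact Or.inr (Or.inr (by omega))
      · rcases hgB hrB with h1 | h1
        · exact Or.inr (Or.inl h1)
        · exact Or.inr (Or.inr (by omega))

/-- The diameter of the set of states shrinks by a uniform factor. -/
theorem exists_contraction (h : S.Admissible τmin τmax τd amin amax) (hn : 0 < n) (hτd : 0 ≤ τd)
    {x : ℝ → Fin n → ℝ} (hx : S.Relaxes x) {T : ℝ} (hT : 0 ≤ T)
    (hG : ∀ t₀ : ℝ, 0 ≤ t₀ → HasSpanningTree (S.unionGraph t₀ T)) :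
    ∃ η : ℝ, 0 ≤ η ∧ η < 1 ∧ ∀ b m M : ℝ, 0 ≤ b → (∀ s, b ≤ s → ∀ i, m ≤ x s i) →
      (∀ s, b ≤ s → ∀ i, x s i ≤ M) → ∃ b' m' M' : ℝ, 0 ≤ b' ∧
        (∀ s, b' ≤ s → ∀ i, m' ≤ x s i) ∧ (∀ s, b' ≤ s → ∀ i, x s i ≤ M') ∧
        M' - m' = η * (M - m) := by
  have hτmax : 0 ≤ τmax := by linarith [h.gaps.1, h.gaps.2 ⟨0, hn⟩ 0]
  obtain ⟨L, hL⟩ : ∃ L, L = τd + τmax + T + τmax := ⟨_, rfl⟩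
  have hL0 : 0 ≤ L := by rw [hL]; positivity
  have hc0 := pow_pos (h.inherit_pos hn L) n
  have hc1 : inherit n τmin amin amax L ^ n ≤ 1 :=
    pow_le_one₀ (h.inherit_pos hn L).le
      ((h.inherit_le hn hL0).trans (Real.exp_le_one_iff.2 (by linarith)))
  have he0 := Real.exp_pos (-(τd + τmax))
  have he1 : Real.exp (-(τd + τmax)) ≤ 1 := Real.exp_le_one_iff.2 (by linarith)
  have hq1 := mul_le_one₀ he1 hc0.le hc1
  have hq0 := mul_pos he0 hc0
  refine ⟨1 - Real.exp (-(τd + τmax)) * inherit n τmin amin amax L ^ n / 2, by linarith,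
    by linarith, fun b m M hb hm hM => ?_⟩
  obtain ⟨A, B, hA, hB, -, hcard⟩ := h.exists_avoiding hn hτd hx hT hG hb hm hM hL hτmax n
  have hnL : 0 ≤ (n : ℝ) * L := by positivity
  have hAB : A = Finset.univ ∨ B = Finset.univ := by
    rcases hcard with h1 | h1 | h1
    · exact Or.inl h1
    · exact Or.inr h1
    · refine Or.inl ((Finset.card_eq_iff_eq_univ A).1 ?_)
      have hcA := Finset.card_le_univ A
      have hcB := Finset.card_le_univ B
      rw [Fintype.card_fin] at *
      omega
  rcases hAB with rfl | rfl
  · have hlow := h.exp_mul_le_of_forall_le hτd hτmax (h.relaxes_affine hx (-m) 1) hb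
      (fun s hs i => by linarith [hm s hs i]) (by linarith) (fun i => hA i (Finset.mem_univ i))
    refine ⟨b + (τd + τmax) + n * L, m + Real.exp (-(τd + τmax)) * (inherit n τmin amin amax L ^ n * ((M - m) / 2)), M,
      by positivity, fun s hs i => by linarith [hlow s hs i],
      fun s hs i => hM s (by linarith) i, by ring⟩
  · have hlow := h.exp_mul_le_of_forall_le hτd hτmax (h.relaxes_affine hx M (-1)) hb
      (fun s hs i => by linarith [hM s hs i]) (by linarith) (fun i => hB i (Finset.mem_univ i))
    refine ⟨b + (τd + τmax) + n * L, m, M - Real.exp (-(τd + τmax)) * (inherit n τmin amin amax L ^ n * ((M - m) / 2)),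
      by positivity, fun s hs i => hm s (by linarith) i,
      fun s hs i => by linarith [hlow s hs i], by ring⟩

/-- A continuous relaxing evolution is bounded from some time on. -/
theorem exists_bounds (h : S.Admissible τmin τmax τd amin amax) (hn : 0 < n) (hτd : 0 ≤ τd)
    {x : ℝ → Fin n → ℝ} (hx : S.Relaxes x)
    (hcont : ∀ i, ContinuousOn (fun t => x t i) (Set.Ici 0)) :
    ∃ C, ∀ s, 0 ≤ s → ∀ i, -C ≤ x s i ∧ x s i ≤ C := by
  have hτmax : 0 ≤ τmax := by linarith [h.gaps.1, h.gaps.2 ⟨0, hn⟩ 0]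
  have hbd : ∀ i, ∃ C, ∀ s ∈ Set.Icc 0 (τd + τmax), ‖x s i‖ ≤ C := fun i =>
    isCompact_Icc.exists_bound_of_continuousOn ((hcont i).mono fun _ hs => hs.1)
  choose C hC using hbd
  have hC' : ∀ s, 0 ≤ s → s ≤ τd + τmax → ∀ i, |x s i| ≤ ∑ i, |C i| := fun s h0 h1 i =>
    ((hC i s ⟨h0, h1⟩).trans (le_abs_self _)).trans
      (Finset.single_le_sum (f := fun i => |C i|) (fun _ _ => abs_nonneg _) (Finset.mem_univ i))
  refine ⟨∑ i, |C i|, fun s hs i => ⟨?_, ?_⟩⟩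
  · have := h.nonneg_of_window (h.relaxes_affine hx (∑ i, |C i|) 1) Set.univ
      (fun _ _ _ _ _ => trivial) (t₀ := τd + τmax) (by linarith) hτd
      (fun s _ h1 h2 i _ => by linarith [(abs_le.1 (hC' s (by linarith) h2 i)).1])
      s (by linarith) (by linarith) i trivial
    linarith
  · have := h.nonneg_of_window (h.relaxes_affine hx (∑ i, |C i|) (-1)) Set.univ
      (fun _ _ _ _ _ => trivial) (t₀ := τd + τmax) (by linarith) hτd
      (fun s _ h1 h2 i _ => by linarith [(abs_le.1 (hC' s (by linarith) h2 i)).2])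
      s (by linarith) (by linarith) i trivial
    linarith

theorem exists_tendsto (h : S.Admissible τmin τmax τd amin amax) (hn : 0 < n) (hτd : 0 ≤ τd)
    {x : ℝ → Fin n → ℝ} (hx : S.Relaxes x)
    (hcont : ∀ i, ContinuousOn (fun t => x t i) (Set.Ici 0)) {T : ℝ} (hT : 0 ≤ T)
    (hG : ∀ t₀ : ℝ, 0 ≤ t₀ → HasSpanningTree (S.unionGraph t₀ T)) :
    ∃ a : ℝ, ∀ i, Tendsto (fun t => x t i) atTop (𝓝 a) := by
  obtain ⟨C, hC⟩ := h.exists_bounds hn hτd hx hcont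
  obtain ⟨η, hη0, hη1, hcontr⟩ := h.exists_contraction hn hτd hx hT hG
  have hiter : ∀ p : ℕ, ∃ b m M : ℝ, 0 ≤ b ∧ (∀ s, b ≤ s → ∀ i, m ≤ x s i) ∧
      (∀ s, b ≤ s → ∀ i, x s i ≤ M) ∧ M - m = η ^ p * (2 * C) := fun p => by
    induction p with
    | zero => exact ⟨0, -C, C, le_rfl, fun s hs i => (hC s hs i).1, fun s hs i => (hC s hs i).2,
        by ring⟩
    | succ p ih =>
      obtain ⟨b, m, M, hb, hm, hM, hd⟩ := ih
      obtain ⟨b', m', M', hb', hm', hM', hd'⟩ := hcontr b m M hb hm hM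
      exact ⟨b', m', M', hb', hm', hM', by rw [hd', hd]; ring⟩
  have hclose : ∀ ε > 0, ∃ b, ∀ s, b ≤ s → ∀ t, b ≤ t → ∀ i j, |x s i - x t j| < ε := by
    intro ε hε
    have hlim : Tendsto (fun p : ℕ => η ^ p * (2 * C)) atTop (𝓝 0) := by
      simpa using (tendsto_pow_atTop_nhds_zero_of_lt_one hη0 hη1).mul_const (2 * C)
    obtain ⟨p, hp⟩ := (hlim.eventually (gt_mem_nhds hε)).exists
    obtain ⟨b, m, M, -, hm, hM, hd⟩ := hiter p
    refine ⟨b, fun s hs t ht i j => abs_lt.2 ⟨?_, ?_⟩⟩ <;>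
      linarith [hm s hs i, hM s hs i, hm t ht j, hM t ht j]
  have hcauchy : CauchySeq fun t => x t ⟨0, hn⟩ := Metric.cauchySeq_iff.2 fun ε hε => by
    obtain ⟨b, hb⟩ := hclose ε hε
    exact ⟨b, fun s hs t ht => hb s hs t ht _ _⟩
  obtain ⟨a, ha⟩ := cauchySeq_tendsto_of_complete hcauchy
  refine ⟨a, fun i => ?_⟩
  have hdiff : Tendsto (fun t => x t i - x t ⟨0, hn⟩) atTop (𝓝 0) :=
    Metric.tendsto_atTop.2 fun ε hε => by
      obtain ⟨b, hb⟩ := hclose ε hε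
      exact ⟨b, fun t ht => by simpa using hb t ht t ht i ⟨0, hn⟩⟩
  simpa using hdiff.add ha

theorem velocity_eq (h : S.Admissible τmin τmax τd amin amax) (x : ℝ → Fin n → ℝ) {i : Fin n}
    {k : ℕ} (hk : (S.recv i k).Nonempty) (t : ℝ) :
    S.velocity x i k t = S.aim x i k - x t i := by
  simp only [velocity, aim, if_pos hk, mul_sub, Finset.sum_sub_distrib, ← Finset.sum_mul,
    h.sum_div_eq_one hk, one_mul]

end Admissible

theorem IsTrajectory.relaxes {φ x : ℝ → Fin n → ℝ}
    (h : S.Admissible τmin τmax τd amin amax) (hx : S.IsTrajectory τd φ x) : S.Relaxes x := by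
  intro i k t ht
  have hcont : ContinuousOn (fun s => x s i) (Set.Icc (S.time i k) (S.time i (k + 1))) :=
    (hx.continuous i).mono fun s hs => (h.time_nonneg i k).trans hs.1
  have hder : ∀ s ∈ Set.Ico (S.time i k) (S.time i (k + 1)),
      HasDerivWithinAt (fun s => x s i) (S.velocity x i k s) (Set.Ici s) s := fun s hs =>
    (hx.dynamics i k s hs).mono_of_mem_nhdsWithin
      (mem_of_superset (Ico_mem_nhdsGE hs.2) (Set.Ico_subset_Ico_left hs.1))
  by_cases hk : (S.recv i k).Nonempty
  · have hexp : ∀ s, HasDerivAt (fun s => Real.exp (s - S.time i k))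
        (Real.exp (s - S.time i k)) s := fun s => by
      simpa using ((hasDerivAt_id s).sub_const (S.time i k)).exp
    have hconst := constant_of_has_deriv_right_zero
      (f := fun s => Real.exp (s - S.time i k) * (x s i - S.aim x i k))
      (((by fun_prop : Continuous fun s => Real.exp (s - S.time i k)).continuousOn).mul
        (hcont.sub continuousOn_const)) (fun s hs => by
          refine ((hexp s).hasDerivWithinAt.mul
            ((hder s hs).sub_const (S.aim x i k))).congr_deriv ?_
          rw [h.velocity_eq x hk]
          ring) t ht
    simp only [sub_self, Real.exp_zero, one_mul] at hconst
    rw [← hconst, ← mul_assoc, ← Real.exp_add]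
    simp
  · have hconst := constant_of_has_deriv_right_zero hcont (fun s hs => by
      have := hder s hs
      rwa [velocity, if_neg hk] at this) t ht
    simp [aim, if_neg hk, hconst]

theorem Relaxes.isTrajectory {φ x : ℝ → Fin n → ℝ}
    (h : S.Admissible τmin τmax τd amin amax) (hx : S.Relaxes x)
    (hφ : ∀ t ∈ Set.Icc (-τd) 0, x t = φ t) : S.IsTrajectory τd φ x where
  initial := hφ
  continuous i := by
    have hpiece : ∀ k, ContinuousOn (fun t => x t i) (Set.Icc (S.time i k) (S.time i (k + 1))) :=
      fun k => ContinuousOn.congr (by fun_prop) fun t ht => hx i k t ht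
    have hinit : ∀ k, ContinuousOn (fun t => x t i) (Set.Icc 0 (S.time i k)) := fun k => by
      induction k with
      | zero => simp [h.start i]
      | succ k ih =>
        rw [← Set.Icc_union_Icc_eq_Icc (h.time_nonneg i k) (h.gaps.strictMono i k.lt_succ_self).le]
        exact ih.union_of_isClosed (hpiece k) isClosed_Icc isClosed_Icc
    intro t ht
    obtain ⟨k, hk⟩ := h.exists_lt_time i t
    refine ((hinit k) t ⟨ht, hk.le⟩).mono_of_mem_nhdsWithin ?_
    rw [← Set.Ici_inter_Iic]
    exact inter_mem_nhdsWithin _ (Iic_mem_nhds hk)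
  dynamics i k t ht := by
    have hform : HasDerivAt (fun s => S.aim x i k +
        Real.exp (-(s - S.time i k)) * (x (S.time i k) i - S.aim x i k))
        (-(Real.exp (-(t - S.time i k)) * (x (S.time i k) i - S.aim x i k))) t := by
      refine ((((((hasDerivAt_id t).sub_const (S.time i k)).neg).exp).mul_const
        (x (S.time i k) i - S.aim x i k)).const_add (S.aim x i k)).congr_deriv ?_
      simp
    have hIcc : ∀ s ∈ Set.Ico (S.time i k) (S.time i (k + 1)), _ := fun s hs =>
      hx i k s ⟨hs.1, hs.2.le⟩
    have hv : S.velocity x i k t =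
        -(Real.exp (-(t - S.time i k)) * (x (S.time i k) i - S.aim x i k)) := by
      by_cases hk : (S.recv i k).Nonempty
      · rw [h.velocity_eq x hk, hIcc t ht]
        ring
      · simp [velocity, aim, if_neg hk]
    rw [hv]
    exact hform.hasDerivWithinAt.congr hIcc (hIcc t ht)

/-- The index of the update interval of agent `i` that contains `t > 0`, with update intervals
taken open on the left and closed on the right. -/
noncomputable def lastUpdate (S : DelayNetwork n) (i : Fin n) (t : ℝ) : ℕ :=
  sInf {k | t ≤ S.time i (k + 1)}

theorem Admissible.lastUpdate_eq (h : S.Admissible τmin τmax τd amin amax) {i : Fin n} {k : ℕ}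
    {t : ℝ} (ht : t ∈ Set.Ioc (S.time i k) (S.time i (k + 1))) : S.lastUpdate i t = k := by
  refine le_antisymm (Nat.sInf_le ht.2) (le_csInf ⟨k, ht.2⟩ fun m hm => ?_)
  have := (h.gaps.strictMono i).lt_iff_lt.1 (ht.1.trans_le hm)
  omega

/-- One step of the iteration that constructs trajectories: the state at `t` is computed from
the states up to the latest update before `t`. -/
noncomputable def advance (S : DelayNetwork n) (φ x : ℝ → Fin n → ℝ) : ℝ → Fin n → ℝ := fun t i =>
  if 0 < t then
    S.aim x i (S.lastUpdate i t) + Real.exp (-(t - S.time i (S.lastUpdate i t))) *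
      (x (S.time i (S.lastUpdate i t)) i - S.aim x i (S.lastUpdate i t))
  else φ t i

namespace Admissible

theorem advance_congr (h : S.Admissible τmin τmax τd amin amax) (φ : ℝ → Fin n → ℝ)
    {x y : ℝ → Fin n → ℝ} {t : ℝ} (hxy : ∀ s, S.eventCount s < S.eventCount t → x s = y s) :
    S.advance φ x t = S.advance φ y t := by
  funext i
  unfold advance
  split_ifs with ht
  · obtain ⟨k, hk⟩ := h.exists_mem_Ioc i ht
    rw [h.lastUpdate_eq hk]
    have hself := hxy _ (h.eventCount_lt le_rfl hk.1)
    have haim : S.aim x i k = S.aim y i k := by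
      unfold aim
      rw [hself]
      congr 1
      refine Finset.sum_congr rfl fun j hj => ?_
      rw [hxy _ (h.eventCount_lt (by linarith [(h.delays i k j hj).1]) hk.1)]
    rw [haim, hself]
  · rfl

theorem exists_isTrajectory (h : S.Admissible τmin τmax τd amin amax) (φ : ℝ → Fin n → ℝ) :
    ∃ x, S.IsTrajectory τd φ x := by
  have hstable : ∀ t p q, S.eventCount t < p → S.eventCount t < q →
      (S.advance φ)^[p] φ t = (S.advance φ)^[q] φ t := by
    intro t
    induction hm : S.eventCount t using Nat.strong_induction_on generalizing t with
    | _ m ih =>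
      intro p q hp hq
      obtain ⟨p, rfl⟩ := Nat.exists_eq_add_one_of_ne_zero (by omega : p ≠ 0)
      obtain ⟨q, rfl⟩ := Nat.exists_eq_add_one_of_ne_zero (by omega : q ≠ 0)
      rw [Function.iterate_succ_apply', Function.iterate_succ_apply']
      exact h.advance_congr φ fun s hs => ih _ (hm ▸ hs) s rfl p q (by omega) (by omega)
  obtain ⟨x, hx⟩ : ∃ x : ℝ → Fin n → ℝ, ∀ t, x t = S.advance φ x t :=
    ⟨fun t => (S.advance φ)^[S.eventCount t + 1] φ t, fun t =>
      (congrFun (Function.iterate_succ_apply' _ _ _) t).trans <|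
        h.advance_congr φ fun s hs => hstable s _ _ hs (Nat.lt_succ_self _)⟩
  refine ⟨x, Relaxes.isTrajectory h (fun i k t ht => ?_) fun t ht => ?_⟩
  · rcases ht.1.eq_or_lt with rfl | hlt
    · simp
    · conv_lhs => rw [hx]
      rw [advance, if_pos ((h.time_nonneg i k).trans_lt hlt), h.lastUpdate_eq ⟨hlt, ht.2⟩]
  · rw [hx]
    funext i
    rw [advance, if_neg (not_lt.2 ht.2)]

/-- A trajectory that starts with a constant value on a set of agents receiving nothing from
outside keeps this value there. -/
theorem eq_const_of_closed (h : S.Admissible τmin τmax τd amin amax) (hτd : 0 ≤ τd)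
    {φ x : ℝ → Fin n → ℝ} (hx : S.IsTrajectory τd φ x) {P : Set (Fin n)}
    (hP : ∀ i ∈ P, ∀ k, ∀ j ∈ S.recv i k, j ∈ P) {c : ℝ} (hφ : ∀ t, ∀ i ∈ P, φ t i = c) {t : ℝ}
    (ht : 0 ≤ t) {i : Fin n} (hi : i ∈ P) : x t i = c := by
  have hτmax : 0 ≤ τmax := by linarith [h.gaps.1, h.gaps.2 i 0]
  have hinit : ∀ s, -τd ≤ s → s ≤ 0 → ∀ j ∈ P, x s j = c := fun s h1 h2 j hj => by
    rw [hx.initial s ⟨h1, h2⟩, hφ s j hj]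
  have h1 := h.nonneg_of_window (h.relaxes_affine (hx.relaxes h) (-c) 1) P hP le_rfl hτd
    (fun s h1 _ h2 j hj => by linarith [hinit s h1 h2 j hj]) t (by linarith) (by linarith) i hi
  have h2 := h.nonneg_of_window (h.relaxes_affine (hx.relaxes h) c (-1)) P hP le_rfl hτd
    (fun s h1 _ h2 j hj => by linarith [hinit s h1 h2 j hj]) t (by linarith) (by linarith) i hi
  linarith

theorem hasSpanningTree_of_solvesConsensus (h : S.Admissible τmin τmax τd amin amax) (hn : 0 < n)
    (hτd : 0 ≤ τd) {Φ : Set (ℝ → Fin n → ℝ)} (hΦ : ∀ c : Fin n → ℝ, (fun _ => c) ∈ Φ)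
    {G : Digraph (Fin n)} (hG : ∀ t, 0 ≤ t → S.topology t = G) (hS : S.SolvesConsensus τd Φ) :
    HasSpanningTree G := by
  classical
  by_contra hno
  have : Nonempty (Fin n) := ⟨⟨0, hn⟩⟩
  obtain ⟨u, v, huv⟩ := exists_disjoint_ancestors G hno
  have hclosed : ∀ w, ∀ i ∈ {i | Relation.ReflTransGen G.Adj i w}, ∀ k, ∀ j ∈ S.recv i k,
      j ∈ {i | Relation.ReflTransGen G.Adj i w} := fun w i hi k j hj => by
    have hadj := (h.recv i k j hj).2
    rw [hG _ (h.time_nonneg i k)] at hadj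
    exact Relation.ReflTransGen.head hadj hi
  obtain ⟨⟨x, hx⟩, hlim⟩ := hS _ (hΦ fun i => if Relation.ReflTransGen G.Adj i u then 0 else 1)
  obtain ⟨a, ha⟩ := hlim x hx
  have hu : ∀ t, 0 ≤ t → x t u = 0 := fun t ht =>
    h.eq_const_of_closed hτd hx (hclosed u) (fun _ i hi => if_pos hi) ht .refl
  have hv : ∀ t, 0 ≤ t → x t v = 1 := fun t ht =>
    h.eq_const_of_closed hτd hx (hclosed v) (fun _ i hi => if_neg fun hi' => huv i hi' hi) ht .refl
  have h0 : a = 0 := tendsto_nhds_unique (ha u)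
    (tendsto_const_nhds.congr' ((eventually_ge_atTop 0).mono fun t ht => (hu t ht).symm))
  have h1 : a = 1 := tendsto_nhds_unique (ha v)
    (tendsto_const_nhds.congr' ((eventually_ge_atTop 0).mono fun t ht => (hv t ht).symm))
  linarith

end Admissible
end DelayNetwork

theorem mainTheorem1 (n : ℕ) (hn : 0 < n) (S : DelayNetwork n)
    (τmin τmax : ℝ) (K : ℕ) (amin amax : ℝ)
    (hrecv : S.ReceivesThroughChannels)
    (hA1 : S.UpdateGaps τmin τmax)
    (hA2 : S.StartsAtZero)
    (hA3 : S.DelaysBounded (K * τmin))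
    (hweight : S.WeightsBounded amin amax)
    (Φ : Set (ℝ → Fin n → ℝ)) (hΦ : ∀ c : Fin n → ℝ, (fun _ => c) ∈ Φ) :
    ((∃ T : ℝ, 0 ≤ T ∧ ∀ t₀ : ℝ, 0 ≤ t₀ → HasSpanningTree (S.unionGraph t₀ T)) →
      S.SolvesConsensus (K * τmin) Φ) ∧
    ((∀ s t : ℝ, 0 ≤ s → 0 ≤ t → S.topology s = S.topology t) →
      S.SolvesConsensus (K * τmin) Φ →
      ∀ t : ℝ, 0 ≤ t → HasSpanningTree (S.topology t)) := by
  have h : S.Admissible τmin τmax (K * τmin) amin amax := ⟨hrecv, hA1, hA2, hA3, hweight⟩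
  have hτd : 0 ≤ K * τmin := mul_nonneg K.cast_nonneg hA1.1.le
  refine ⟨?_, fun hconst hS t ht => ?_⟩
  · rintro ⟨T, hT, hG⟩ φ -
    exact ⟨h.exists_isTrajectory φ, fun x hx =>
      h.exists_tendsto hn hτd (hx.relaxes h) hx.continuous hT hG⟩
  · exact h.hasSpanningTree_of_solvesConsensus hn hτd hΦ (fun s hs => hconst s t hs ht) hS
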